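/- Let $V$ and $F$ be finite sets (variables and factors), and for every $n\in F$ let $\mathcal B(f_n)\subseteq V$ be the set of variables involved in the factor $f_n$. Consider the linear Gaussian model $$\mathbf y_n=\sum_{i\in\mathcal B(f_n)}\mathbf A_{n,i}\mathbf x_i+\mathbf z_n,\qquad n\in F,$$ with independent real Gaussian vectors $\mathbf x_i\sim\mathcal N(\mathbf 0,\mathbf W_i)$, $\mathbf z_n\sim\mathcal N(\mathbf 0,\mathbf R_n)$, $\mathbf W_i\succ\mathbf 0$, $\mathbf R_n\succ\mathbf 0$, where $\mathbf A_{n,i}$ has full column rank for all $i\in\mathcal B(f_n)$. Its factor graph is the bipartite graph on $V\sqcup F$ in which the variable $i$ is joined to the factor $f_n$ iff $i\in\mathcal B(f_n)$; write $\mathcal B(j)$ for the set of factors adjacent to $j\in V$. Given initial data $\mathbf J^{(0)}_{f_n\to i}$, $\mathbf v^{(0)}_{f_n\to i}$ ($i\in\mathcal B(f_n)$), Gaussian belief propagation computes, for $\ell\ge 1$, $$\mathbf J^{(\ell)}_{j\to f_n}=\mathbf W_j^{-1}+\sum_{f_k\in\mathcal B(j)\setminus f_n}\mathbf J^{(\ell-1)}_{f_k\to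 j},\qquad \mathbf v^{(\ell)}_{j\to f_n}=\big[\mathbf J^{(\ell)}_{j\to f_n}\big]^{-1}\sum_{f_k\in\mathcal B(j)\setminus f_n}\mathbf J^{(\ell-1)}_{f_k\to j}\mathbf v^{(\ell-1)}_{f_k\to j},$$ $$\mathbf M^{(\ell)}_{n,i}=\mathbf R_n+\sum_{j\in\mathcal B(f_n)\setminus i}\mathbf A_{n,j}\big[\mathbf J^{(\ell)}_{j\to f_n}\big]^{-1}\mathbf A_{n,j}^T,\qquad \mathbf J^{(\ell)}_{f_n\to i}=\mathbf A_{n,i}^T\big[\mathbf M^{(\ell)}_{n,i}\big]^{-1}\mathbf A_{n,i},$$ $$\mathbf v^{(\ell)}_{f_n\to i}=\big[\mathbf J^{(\ell)}_{f_n\to i}\big]^{-1}\mathbf A_{n,i}^T\big[\mathbf M^{(\ell)}_{n,i}\big]^{-1}\Big(\mathbf y_n-\sum_{j\in\mathcal B(f_n)\setminus i}\mathbf A_{n,j}\mathbf v^{(\ell)}_{j\to f_n}\Big).$$ Theorem 6. Suppose that the factor graph is the union of a single loop and a forest, that is, it contains exactly one cycle. Then for every $n\in F$ and $i\in\mathcal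 B(f_n)$ there is a unique matrix $\mathbf J^{*}_{f_n\to i}$ such that, for arbitrary positive semidefinite initial information matrices $\mathbf J^{(0)}_{f_k\to j}\succeq\mathbf 0$ ($k\in F$, $j\in\mathcal B(f_k)$), $\mathbf J^{(\ell)}_{f_n\to i}\to\mathbf J^{*}_{f_n\to i}$ as $\ell\to\infty$; and, for all observations $\mathbf y$, there is a unique vector $\mathbf v^{*}_{i\to f_n}$ such that, for arbitrary positive semidefinite initial information matrices $\mathbf J^{(0)}_{f_k\to j}\succeq\mathbf 0$ and arbitrary initial mean vectors $\mathbf v^{(0)}_{f_k\to j}$, $\mathbf v^{(\ell)}_{i\to f_n}\to\mathbf v^{*}_{i\to f_n}$ as $\ell\to\infty$. In particular, both limits are independent of the initialization. -/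

import Mathlib

open Filter Topology
open scoped Matrix

/-- A simple graph that is the union of a single loop and a forest: it contains a cycle, and
all of its cycles have the same edges (so there is exactly one loop, and everything else is
tree-like). The graph need not be connected. -/
def IsSingleLoopWithForest {X : Type*} (G : SimpleGraph X) : Prop :=
  ∃ (u : X) (c : G.Walk u u), c.IsCycle ∧
    ∀ (w : X) (c' : G.Walk w w), c'.IsCycle → ∀ e : Sym2 X, e ∈ c'.edges ↔ e ∈ c.edges

/-- The linear Gaussian model `y n = ∑ i ∈ scope n, A n i * x i + z n`, one local observation
for every factor `n : F`, with independent priors `x i ∼ N(0, W i)`, `i : V`, and independent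
noises `z n ∼ N(0, R n)`. The set `scope n` is the set of variables that are involved in the
factor `n`; the matrices `A n i` with `i ∉ scope n` play no role. -/
structure LinearGaussianModel (V F : Type*) where
  /-- the variables that are involved in a factor -/
  scope : F → Finset V
  /-- the dimension of the unknown `x i` -/
  dim : V → ℕ
  /-- the dimension of the observation `y n` -/
  obs : F → ℕ
  /-- the coefficient matrices -/
  A : (n : F) → (i : V) → Matrix (Fin (obs n)) (Fin (dim i)) ℝ
  /-- the prior covariances -/
  W : (i : V) → Matrix (Fin (dim i)) (Fin (dim i)) ℝ
  /-- the noise covariances -/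
  R : (n : F) → Matrix (Fin (obs n)) (Fin (obs n)) ℝ
  /-- the coefficient matrices have full column rank -/
  rank_A : ∀ n, ∀ i ∈ scope n, (A n i).rank = dim i
  posDef_W : ∀ i, (W i).PosDef
  posDef_R : ∀ n, (R n).PosDef

namespace LinearGaussianModel

variable {V F : Type*} (M : LinearGaussianModel V F)

/-- The factor graph: the nodes are the variables and the factors, and a variable is joined to
a factor if it is involved in that factor. -/
def factorGraph : SimpleGraph (V ⊕ F) where
  Adj
    | Sum.inl i, Sum.inr n => i ∈ M.scope n
    | Sum.inr n, Sum.inl i => i ∈ M.scope n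
    | _, _ => False
  symm := by
    constructor
    rintro (i | n) (j | k) h <;> exact h
  loopless := by
    constructor
    rintro (i | n) h <;> exact h

/-- Families of matrices, the entry `J n i` belonging to the message from factor `n` to
variable `i`; only the entries with `i ∈ scope n` are meaningful. -/
abbrev FactorInfo : Type _ := (n : F) → (i : V) → Matrix (Fin (M.dim i)) (Fin (M.dim i)) ℝ

/-- Families of vectors, the entry `v n i` belonging to the message from factor `n` to
variable `i`; only the entries with `i ∈ scope n` are meaningful. -/
abbrev FactorMean : Type _ := (n : F) → (i : V) → (Fin (M.dim i) → ℝ)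

/-- Families of matrices, the entry `K j n` belonging to the message from variable `j` to
factor `n`. -/
abbrev VarInfo : Type _ := (j : V) → F → Matrix (Fin (M.dim j)) (Fin (M.dim j)) ℝ

/-- Families of vectors, the entry `u j n` belonging to the message from variable `j` to
factor `n`. -/
abbrev VarMean : Type _ := (j : V) → F → (Fin (M.dim j) → ℝ)

/-- The information matrices of all messages from factors to variables are positive
semidefinite. -/
def IsPSDInit (J₀ : M.FactorInfo) : Prop :=
  ∀ n, ∀ i ∈ M.scope n, (J₀ n i).PosSemidef

variable [DecidableEq V] [Fintype F] [DecidableEq F]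

/-- The factors that are adjacent to the variable `j`, except the factor `n`. -/
def otherFactors (j : V) (n : F) : Finset F :=
  Finset.univ.filter fun k => j ∈ M.scope k ∧ k ≠ n

/-- The information matrix of the message from variable `j` to factor `n`,
`W j ⁻¹ + ∑ k, J k j`, the sum being over the factors `k ≠ n` adjacent to `j`. -/
noncomputable def varInfo (J : M.FactorInfo) : M.VarInfo := fun j n =>
  (M.W j)⁻¹ + ∑ k ∈ M.otherFactors j n, J k j

/-- The mean of the message from variable `j` to factor `n`. -/
noncomputable def varMean (J : M.FactorInfo) (v : M.FactorMean) : M.VarMean := fun j n =>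
  (M.varInfo J j n)⁻¹ *ᵥ ∑ k ∈ M.otherFactors j n, J k j *ᵥ v k j

/-- The covariance matrix `R n + ∑ j, A n j * (K j n)⁻¹ * (A n j)ᵀ` of the observation `y n`
as it is seen from the variable `i`, the sum being over the `j ∈ scope n`, `j ≠ i`. -/
noncomputable def residualCov (K : M.VarInfo) (n : F) (i : V) :
    Matrix (Fin (M.obs n)) (Fin (M.obs n)) ℝ :=
  M.R n + ∑ j ∈ (M.scope n).erase i, M.A n j * (K j n)⁻¹ * (M.A n j)ᵀ

/-- The information matrix of the message from factor `n` to variable `i`. -/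
noncomputable def factorInfo (K : M.VarInfo) : M.FactorInfo := fun n i =>
  (M.A n i)ᵀ * (M.residualCov K n i)⁻¹ * M.A n i

/-- The mean of the message from factor `n` to variable `i`. -/
noncomputable def factorMean (y : (n : F) → (Fin (M.obs n) → ℝ)) (K : M.VarInfo)
    (u : M.VarMean) : M.FactorMean := fun n i =>
  ((M.factorInfo K n i)⁻¹ * (M.A n i)ᵀ * (M.residualCov K n i)⁻¹) *ᵥ
    (y n - ∑ j ∈ (M.scope n).erase i, M.A n j *ᵥ u j n)

/-- The information matrices of the messages from factors to variables after `l` rounds of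
Gaussian belief propagation. -/
noncomputable def infoSeq (J₀ : M.FactorInfo) : ℕ → M.FactorInfo
  | 0 => J₀
  | l + 1 => M.factorInfo (M.varInfo (infoSeq J₀ l))

/-- The means of the messages from factors to variables after `l` rounds of Gaussian belief
propagation. -/
noncomputable def meanSeq (y : (n : F) → (Fin (M.obs n) → ℝ)) (J₀ : M.FactorInfo)
    (v₀ : M.FactorMean) : ℕ → M.FactorMean
  | 0 => v₀
  | l + 1 => M.factorMean y (M.varInfo (M.infoSeq J₀ l))
      (M.varMean (M.infoSeq J₀ l) (meanSeq y J₀ v₀ l))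

/-- The means of the messages from variables to factors that are computed in round `l + 1`,
from the messages from factors to variables after round `l`. -/
noncomputable def varMeanSeq (y : (n : F) → (Fin (M.obs n) → ℝ)) (J₀ : M.FactorInfo)
    (v₀ : M.FactorMean) (l : ℕ) : M.VarMean :=
  M.varMean (M.infoSeq J₀ l) (M.meanSeq y J₀ v₀ l)

end LinearGaussianModel

namespace Matrix

theorem IsHermitian.transpose_eq {m : Type*} {A : Matrix m m ℝ} (hA : A.IsHermitian) : Aᵀ = A := by
  simpa [IsHermitian, conjTranspose_eq_transpose_of_trivial] using hA

theorem isClosed_isHermitian {m : Type*} : IsClosed {A : Matrix m m ℝ | A.IsHermitian} := by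
  simp only [IsHermitian]
  exact isClosed_eq (by fun_prop) continuous_id

variable {m k : Type*} [Fintype m] [Fintype k]

/-- The quadratic form of a real square matrix. -/
def quadForm (A : Matrix m m ℝ) (x : m → ℝ) : ℝ := x ⬝ᵥ A *ᵥ x

theorem quadForm_add (A B : Matrix m m ℝ) (x : m → ℝ) :
    (A + B).quadForm x = A.quadForm x + B.quadForm x := by
  simp [quadForm, add_mulVec]

theorem quadForm_zero (x : m → ℝ) : (0 : Matrix m m ℝ).quadForm x = 0 := by
  simp [quadForm]

theorem quadForm_smul (c : ℝ) (A : Matrix m m ℝ) (x : m → ℝ) :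
    (c • A).quadForm x = c * A.quadForm x := by
  simp [quadForm, smul_mulVec]

theorem quadForm_sum {ι : Type*} (s : Finset ι) (A : ι → Matrix m m ℝ) (x : m → ℝ) :
    (∑ i ∈ s, A i).quadForm x = ∑ i ∈ s, (A i).quadForm x := by
  simp [quadForm, sum_mulVec, dotProduct_sum]

theorem quadForm_mul_mul_transpose (B : Matrix k m ℝ) (A : Matrix m m ℝ) (x : k → ℝ) :
    (B * A * Bᵀ).quadForm x = A.quadForm (Bᵀ *ᵥ x) := by
  simp only [quadForm, ← mulVec_mulVec]
  rw [dotProduct_mulVec, ← mulVec_transpose]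

theorem quadForm_transpose_mul_mul (B : Matrix m k ℝ) (A : Matrix m m ℝ) (x : k → ℝ) :
    (Bᵀ * A * B).quadForm x = A.quadForm (B *ᵥ x) := by
  simpa using quadForm_mul_mul_transpose Bᵀ A x

theorem PosSemidef.quadForm_nonneg {A : Matrix m m ℝ} (hA : A.PosSemidef) (x : m → ℝ) :
    0 ≤ A.quadForm x := by
  simpa [quadForm] using hA.dotProduct_mulVec_nonneg x

theorem PosDef.quadForm_nonneg {A : Matrix m m ℝ} (hA : A.PosDef) (x : m → ℝ) :
    0 ≤ A.quadForm x := hA.posSemidef.quadForm_nonneg x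

theorem IsHermitian.dotProduct_mulVec_comm {A : Matrix m m ℝ} (hA : A.IsHermitian)
    (x y : m → ℝ) : x ⬝ᵥ A *ᵥ y = y ⬝ᵥ A *ᵥ x := by
  rw [dotProduct_mulVec, ← mulVec_transpose, hA.transpose_eq, dotProduct_comm]

theorem IsHermitian.mulVec_dotProduct {A : Matrix m m ℝ} (hA : A.IsHermitian)
    (x y : m → ℝ) : (A *ᵥ x) ⬝ᵥ y = x ⬝ᵥ A *ᵥ y := by
  rw [hA.dotProduct_mulVec_comm x y, dotProduct_comm]

theorem IsHermitian.quadForm_sub {A : Matrix m m ℝ} (hA : A.IsHermitian) (x y : m → ℝ) :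
    A.quadForm (x - y) = A.quadForm x - 2 * (x ⬝ᵥ A *ᵥ y) + A.quadForm y := by
  simp only [quadForm, mulVec_sub, sub_dotProduct, dotProduct_sub]
  rw [hA.dotProduct_mulVec_comm y x]
  ring

theorem IsHermitian.quadForm_add_vec {A : Matrix m m ℝ} (hA : A.IsHermitian) (x y : m → ℝ) :
    A.quadForm (x + y) = A.quadForm x + 2 * (x ⬝ᵥ A *ᵥ y) + A.quadForm y := by
  simp only [quadForm, mulVec_add, add_dotProduct, dotProduct_add]
  rw [hA.dotProduct_mulVec_comm y x]
  ring

theorem exists_quadForm_le_dotProduct_self (B : Matrix m m ℝ) :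
    ∃ b : ℝ, 0 ≤ b ∧ ∀ x, B.quadForm x ≤ b * (x ⬝ᵥ x) := by
  refine ⟨∑ i, ∑ j, |B i j|, Finset.sum_nonneg fun i _ => Finset.sum_nonneg fun j _ =>
    abs_nonneg _, fun x => ?_⟩
  have hx : ∀ i, |x i| ^ 2 ≤ x ⬝ᵥ x := fun i => by
    rw [dotProduct, sq_abs, sq]
    exact Finset.single_le_sum (f := fun i => x i * x i) (fun j _ => mul_self_nonneg _)
      (Finset.mem_univ i)
  rw [quadForm, dotProduct, Finset.sum_mul]
  refine Finset.sum_le_sum fun i _ => ?_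
  rw [mulVec, dotProduct, Finset.sum_mul, Finset.mul_sum]
  refine Finset.sum_le_sum fun j _ => ?_
  calc x i * (B i j * x j) ≤ |x i * (B i j * x j)| := le_abs_self _
    _ = |B i j| * (|x i| * |x j|) := by rw [abs_mul, abs_mul]; ring
    _ ≤ _ := mul_le_mul_of_nonneg_left (by nlinarith [hx i, hx j, sq_nonneg (|x i| - |x j|)])
        (abs_nonneg _)

theorem continuous_quadForm (x : m → ℝ) :
    Continuous fun A : Matrix m m ℝ => A.quadForm x := by
  unfold quadForm; fun_prop

variable [DecidableEq m]

theorem PosDef.mulVec_inv_mulVec {A : Matrix m m ℝ} (hA : A.PosDef) (x : m → ℝ) :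
    A *ᵥ A⁻¹ *ᵥ x = x := by
  rw [mulVec_mulVec, mul_nonsing_inv A ((isUnit_iff_isUnit_det A).1 hA.isUnit), one_mulVec]

theorem PosDef.quadForm_inv {A : Matrix m m ℝ} (hA : A.PosDef) (x : m → ℝ) :
    A⁻¹.quadForm x = A.quadForm (A⁻¹ *ᵥ x) := by
  rw [quadForm, quadForm, hA.mulVec_inv_mulVec, dotProduct_comm]

/-- The variational lower bound for the quadratic form of the inverse. -/
theorem PosDef.two_mul_dotProduct_sub_le {A : Matrix m m ℝ} (hA : A.PosDef) (x u : m → ℝ) :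
    2 * (u ⬝ᵥ x) - A.quadForm u ≤ A⁻¹.quadForm x := by
  have h := hA.quadForm_nonneg (u - A⁻¹ *ᵥ x)
  rw [hA.isHermitian.quadForm_sub, hA.mulVec_inv_mulVec, ← hA.quadForm_inv] at h
  linarith

theorem PosDef.quadForm_inv_le_of_le {A B : Matrix m m ℝ} (hA : A.PosDef) (hB : B.PosDef)
    (h : ∀ x, A.quadForm x ≤ B.quadForm x) (x : m → ℝ) :
    B⁻¹.quadForm x ≤ A⁻¹.quadForm x := by
  have h1 := hA.two_mul_dotProduct_sub_le x (B⁻¹ *ᵥ x)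
  have h2 := h (B⁻¹ *ᵥ x)
  rw [← hB.quadForm_inv] at h2
  have h3 : (B⁻¹ *ᵥ x) ⬝ᵥ x = B⁻¹.quadForm x := by rw [quadForm, dotProduct_comm]
  linarith

theorem PosDef.quadForm_inv_smul {A : Matrix m m ℝ} (hA : A.PosDef) {c : ℝ} (hc : 0 < c)
    (x : m → ℝ) : (c • A)⁻¹.quadForm x = c⁻¹ * A⁻¹.quadForm x := by
  have hdet := (isUnit_iff_isUnit_det A).1 hA.isUnit
  have : (c • A)⁻¹ = c⁻¹ • A⁻¹ := by
    apply inv_eq_right_inv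
    rw [smul_mul_smul_comm, mul_inv_cancel₀ hc.ne', mul_nonsing_inv A hdet, one_smul]
  rw [this, quadForm_smul]

theorem PosDef.sq_dotProduct_le {A : Matrix m m ℝ} (hA : A.PosDef) (h x : m → ℝ) :
    (h ⬝ᵥ x) ^ 2 ≤ A⁻¹.quadForm h * A.quadForm x := by
  have key : ∀ t : ℝ, 2 * (t * (h ⬝ᵥ x)) - A.quadForm x ≤ t ^ 2 * A⁻¹.quadForm h := by
    intro t
    have := hA.two_mul_dotProduct_sub_le (t • h) x
    simp only [quadForm, mulVec_smul, dotProduct_smul, smul_dotProduct, smul_eq_mul] at this ⊢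
    rw [dotProduct_comm x h] at this
    linarith
  have hd := discrim_le_zero (a := A⁻¹.quadForm h) (b := -2 * (h ⬝ᵥ x)) (c := A.quadForm x)
    (fun t => by linarith [key t])
  simp only [discrim] at hd
  linarith

theorem PosDef.exists_dotProduct_self_le {A : Matrix m m ℝ} (hA : A.PosDef) :
    ∃ b : ℝ, 0 ≤ b ∧ ∀ x, x ⬝ᵥ x ≤ b * A.quadForm x := by
  refine ⟨∑ i, A⁻¹.quadForm (Pi.single i 1),
    Finset.sum_nonneg fun i _ => hA.inv.quadForm_nonneg _, fun x => ?_⟩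
  rw [Finset.sum_mul, dotProduct]
  refine Finset.sum_le_sum fun i _ => ?_
  simpa [sq] using hA.sq_dotProduct_le (Pi.single i 1) x

theorem PosDef.exists_quadForm_le {A : Matrix m m ℝ} (hA : A.PosDef) (B : Matrix m m ℝ) :
    ∃ b : ℝ, 0 ≤ b ∧ ∀ x, B.quadForm x ≤ b * A.quadForm x := by
  obtain ⟨a, ha, h1⟩ := hA.exists_dotProduct_self_le
  obtain ⟨b, hb, h2⟩ := exists_quadForm_le_dotProduct_self B
  refine ⟨b * a, mul_nonneg hb ha, fun x => (h2 x).trans ?_⟩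
  rw [mul_assoc]
  exact mul_le_mul_of_nonneg_left (h1 x) hb

theorem IsHermitian.apply_eq_quadForm {A : Matrix m m ℝ} (hA : A.IsHermitian) (i j : m) :
    A i j = (A.quadForm (Pi.single i 1 + Pi.single j 1) - A.quadForm (Pi.single i 1)
      - A.quadForm (Pi.single j 1)) / 2 := by
  rw [hA.quadForm_add_vec]
  simp only [mulVec_single_one, single_one_dotProduct, col_apply]
  ring

theorem tendsto_of_quadForm {ι : Type*} {l : Filter ι} {A : ι → Matrix m m ℝ}
    {B : Matrix m m ℝ} (hA : ∀ᶠ t in l, (A t).IsHermitian) (hB : B.IsHermitian)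
    (h : ∀ x, Tendsto (fun t => (A t).quadForm x) l (𝓝 (B.quadForm x))) :
    Tendsto A l (𝓝 B) := by
  refine tendsto_pi_nhds.2 fun i => tendsto_pi_nhds.2 fun j => ?_
  rw [hB.apply_eq_quadForm]
  refine ((((h _).sub (h _)).sub (h _)).div_const 2).congr' ?_
  filter_upwards [hA] with t ht
  rw [ht.apply_eq_quadForm i j]

/-- A sequence of symmetric matrices whose quadratic forms are monotone and bounded converges. -/
theorem exists_tendsto_of_monotone {A : ℕ → Matrix m m ℝ} (hA : ∀ t, (A t).IsHermitian)
    (hmono : ∀ x, Monotone fun t => (A t).quadForm x) (U : Matrix m m ℝ)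
    (hU : ∀ t x, (A t).quadForm x ≤ U.quadForm x) : ∃ B, Tendsto A atTop (𝓝 B) := by
  have h : ∀ x, ∃ c, Tendsto (fun t => (A t).quadForm x) atTop (𝓝 c) := fun x =>
    ⟨_, tendsto_atTop_ciSup (hmono x) ⟨U.quadForm x, by rintro _ ⟨t, rfl⟩; exact hU t x⟩⟩
  choose c hc using h
  refine ⟨fun i j => (c (Pi.single i 1 + Pi.single j 1) - c (Pi.single i 1)
    - c (Pi.single j 1)) / 2, tendsto_pi_nhds.2 fun i => tendsto_pi_nhds.2 fun j => ?_⟩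
  refine ((((hc _).sub (hc _)).sub (hc _)).div_const 2).congr fun t => ?_
  rw [(hA t).apply_eq_quadForm i j]

theorem PosDef.tendsto_inv {ι : Type*} {l : Filter ι} {A : ι → Matrix m m ℝ}
    {B : Matrix m m ℝ} (hB : B.PosDef) (h : Tendsto A l (𝓝 B)) :
    Tendsto (fun t => (A t)⁻¹) l (𝓝 B⁻¹) := by
  have hdet : B.det ≠ 0 := hB.det_pos.ne'
  simp only [inv_def, Ring.inverse_eq_inv']
  exact ((continuous_id.matrix_det.tendsto B).comp h |>.inv₀ hdet).smul
    ((continuous_id.matrix_adjugate.tendsto B).comp h)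

end Matrix

namespace LinearGaussianModel

open Matrix

variable {V F : Type*} (M : LinearGaussianModel V F)

/-- The information matrices of all messages from variables to factors are positive definite. -/
def IsPosDefInfo (K : M.VarInfo) : Prop := ∀ j n, (K j n).PosDef

variable {M}

theorem mulVec_A_injective {n : F} {i : V} (hi : i ∈ M.scope n) :
    Function.Injective (M.A n i).mulVec := by
  rw [mulVec_injective_iff, linearIndependent_iff_card_eq_finrank_span, Fintype.card_fin,
    Set.finrank, ← rank_eq_finrank_span_cols, M.rank_A n i hi]

theorem IsPosDefInfo.smul {K : M.VarInfo} (hK : M.IsPosDefInfo K) {c : ℝ} (hc : 0 < c) :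
    M.IsPosDefInfo (fun j n => c • K j n) := fun j n => (hK j n).smul hc

theorem isPSDInit_zero (M : LinearGaussianModel V F) : M.IsPSDInit 0 := fun _ _ _ =>
  PosSemidef.zero

variable [DecidableEq V]

theorem IsPosDefInfo.posDef_residualCov {K : M.VarInfo} (hK : M.IsPosDefInfo K) (n : F) (i : V) :
    (M.residualCov K n i).PosDef := by
  refine (M.posDef_R n).add_posSemidef (posSemidef_sum _ fun j _ => ?_)
  have := (hK j n).inv.posSemidef.mul_mul_conjTranspose_same (M.A n j)
  rwa [conjTranspose_eq_transpose_of_trivial] at this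

theorem quadForm_residualCov (K : M.VarInfo) (n : F) (i : V) (x : Fin (M.obs n) → ℝ) :
    (M.residualCov K n i).quadForm x = (M.R n).quadForm x +
      ∑ j ∈ (M.scope n).erase i, (K j n)⁻¹.quadForm ((M.A n j)ᵀ *ᵥ x) := by
  simp only [residualCov, quadForm_add, quadForm_sum, quadForm_mul_mul_transpose]

theorem quadForm_factorInfo (K : M.VarInfo) (n : F) (i : V) (x : Fin (M.dim i) → ℝ) :
    (M.factorInfo K n i).quadForm x = (M.residualCov K n i)⁻¹.quadForm (M.A n i *ᵥ x) :=
  quadForm_transpose_mul_mul _ _ _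

theorem IsPosDefInfo.posSemidef_factorInfo {K : M.VarInfo} (hK : M.IsPosDefInfo K) (n : F)
    (i : V) : (M.factorInfo K n i).PosSemidef := by
  have := (hK.posDef_residualCov n i).inv.posSemidef.conjTranspose_mul_mul_same (M.A n i)
  rwa [conjTranspose_eq_transpose_of_trivial] at this

theorem IsPosDefInfo.posDef_factorInfo {K : M.VarInfo} (hK : M.IsPosDefInfo K) {n : F}
    {i : V} (hi : i ∈ M.scope n) : (M.factorInfo K n i).PosDef := by
  have := (hK.posDef_residualCov n i).inv.conjTranspose_mul_mul_same (mulVec_A_injective hi)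
  rwa [conjTranspose_eq_transpose_of_trivial] at this

theorem factorInfo_mono {K K' : M.VarInfo} (hK : M.IsPosDefInfo K) (hK' : M.IsPosDefInfo K')
    (h : ∀ j n x, (K j n).quadForm x ≤ (K' j n).quadForm x) (n : F) (i : V)
    (x : Fin (M.dim i) → ℝ) :
    (M.factorInfo K n i).quadForm x ≤ (M.factorInfo K' n i).quadForm x := by
  rw [quadForm_factorInfo, quadForm_factorInfo]
  refine (hK'.posDef_residualCov n i).quadForm_inv_le_of_le (hK.posDef_residualCov n i)
    (fun z => ?_) _
  rw [quadForm_residualCov, quadForm_residualCov]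
  gcongr with j
  exact (hK j n).quadForm_inv_le_of_le (hK' j n) (h j n) _

theorem factorInfo_le (M : LinearGaussianModel V F) {K : M.VarInfo} (hK : M.IsPosDefInfo K)
    (n : F) (i : V) (x : Fin (M.dim i) → ℝ) :
    (M.factorInfo K n i).quadForm x ≤ ((M.A n i)ᵀ * (M.R n)⁻¹ * M.A n i).quadForm x := by
  rw [quadForm_factorInfo, quadForm_transpose_mul_mul]
  refine (M.posDef_R n).quadForm_inv_le_of_le (hK.posDef_residualCov n i) (fun z => ?_) _
  rw [quadForm_residualCov]
  exact le_add_of_nonneg_right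
    (Finset.sum_nonneg fun j _ => (hK j n).inv.quadForm_nonneg _)

theorem quadForm_residualCov_smul {K : M.VarInfo} (hK : M.IsPosDefInfo K) {c : ℝ} (hc : 0 < c)
    (n : F) (i : V) (x : Fin (M.obs n) → ℝ) :
    (M.residualCov (fun j n => c • K j n) n i).quadForm x = (M.R n).quadForm x +
      c⁻¹ * ∑ j ∈ (M.scope n).erase i, (K j n)⁻¹.quadForm ((M.A n j)ᵀ *ᵥ x) := by
  rw [quadForm_residualCov, Finset.mul_sum]
  simp only [(hK _ n).quadForm_inv_smul hc]

theorem factorInfo_smul_le {K : M.VarInfo} (hK : M.IsPosDefInfo K) {c : ℝ} (hc : 1 ≤ c)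
    (n : F) (i : V) (x : Fin (M.dim i) → ℝ) :
    (M.factorInfo (fun j n => c • K j n) n i).quadForm x ≤
      c * (M.factorInfo K n i).quadForm x := by
  have hc0 : 0 < c := by linarith
  have hR := hK.posDef_residualCov n i
  rw [quadForm_factorInfo, quadForm_factorInfo]
  conv_rhs => rw [← inv_inv c, ← hR.quadForm_inv_smul (inv_pos.2 hc0)]
  refine (hR.smul (inv_pos.2 hc0)).quadForm_inv_le_of_le
    ((hK.smul hc0).posDef_residualCov n i) (fun z => ?_) _
  rw [quadForm_smul, quadForm_residualCov, quadForm_residualCov_smul hK hc0, mul_add]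
  gcongr
  exact mul_le_of_le_one_left ((M.posDef_R n).quadForm_nonneg z) (inv_le_one_of_one_le₀ hc)

theorem le_factorInfo_smul {K : M.VarInfo} (hK : M.IsPosDefInfo K) {c : ℝ} (hc0 : 0 < c)
    (hc : c ≤ 1) (n : F) (i : V) (x : Fin (M.dim i) → ℝ) :
    c * (M.factorInfo K n i).quadForm x ≤
      (M.factorInfo (fun j n => c • K j n) n i).quadForm x := by
  have hR := hK.posDef_residualCov n i
  rw [quadForm_factorInfo, quadForm_factorInfo]
  conv_lhs => rw [← inv_inv c, ← hR.quadForm_inv_smul (inv_pos.2 hc0)]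
  refine ((hK.smul hc0).posDef_residualCov n i).quadForm_inv_le_of_le
    (hR.smul (inv_pos.2 hc0)) (fun z => ?_) _
  rw [quadForm_smul, quadForm_residualCov_smul hK hc0, quadForm_residualCov, mul_add]
  gcongr
  exact le_mul_of_one_le_left ((M.posDef_R n).quadForm_nonneg z) ((one_le_inv₀ hc0).2 hc)

theorem tendsto_factorInfo {ι : Type*} {l : Filter ι} {K : ι → M.VarInfo} {K' : M.VarInfo}
    (hK' : M.IsPosDefInfo K') (h : ∀ j n, Tendsto (fun t => K t j n) l (𝓝 (K' j n)))
    (n : F) (i : V) :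
    Tendsto (fun t => (M.residualCov (K t) n i)⁻¹) l (𝓝 (M.residualCov K' n i)⁻¹) ∧
    Tendsto (fun t => M.factorInfo (K t) n i) l (𝓝 (M.factorInfo K' n i)) := by
  have h1 : Tendsto (fun t => M.residualCov (K t) n i) l (𝓝 (M.residualCov K' n i)) := by
    refine tendsto_const_nhds.add (tendsto_finsetSum _ fun j _ => ?_)
    have hcont : Continuous fun X : Matrix (Fin (M.dim j)) (Fin (M.dim j)) ℝ =>
      M.A n j * X * (M.A n j)ᵀ := by fun_prop
    exact (hcont.tendsto _).comp ((hK' j n).tendsto_inv (h j n))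
  have h2 := (hK'.posDef_residualCov n i).tendsto_inv h1
  have hcont : Continuous fun X : Matrix (Fin (M.obs n)) (Fin (M.obs n)) ℝ =>
      (M.A n i)ᵀ * X * M.A n i := by fun_prop
  exact ⟨h2, (hcont.tendsto _).comp h2⟩

variable [Fintype F] [DecidableEq F]

theorem mem_otherFactors {j : V} {n k : F} :
    k ∈ M.otherFactors j n ↔ j ∈ M.scope k ∧ k ≠ n := by
  simp [otherFactors]

theorem quadForm_varInfo (J : M.FactorInfo) (j : V) (n : F) (x : Fin (M.dim j) → ℝ) :
    (M.varInfo J j n).quadForm x = (M.W j)⁻¹.quadForm x +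
      ∑ k ∈ M.otherFactors j n, (J k j).quadForm x := by
  simp only [varInfo, quadForm_add, quadForm_sum]

theorem IsPSDInit.isPosDefInfo_varInfo {J : M.FactorInfo} (hJ : M.IsPSDInit J) :
    M.IsPosDefInfo (M.varInfo J) := fun j _ =>
  (M.posDef_W j).inv.add_posSemidef (posSemidef_sum _ fun k hk =>
    hJ k j (mem_otherFactors.1 hk).1)

theorem varInfo_mono {J J' : M.FactorInfo}
    (h : ∀ n, ∀ i ∈ M.scope n, ∀ x, (J n i).quadForm x ≤ (J' n i).quadForm x) (j : V) (n : F)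
    (x : Fin (M.dim j) → ℝ) :
    (M.varInfo J j n).quadForm x ≤ (M.varInfo J' j n).quadForm x := by
  rw [quadForm_varInfo, quadForm_varInfo]
  gcongr with k hk
  exact h k j (mem_otherFactors.1 hk).1 x

theorem tendsto_varInfo {ι : Type*} {l : Filter ι} {J : ι → M.FactorInfo} {J' : M.FactorInfo}
    (h : ∀ n, ∀ i ∈ M.scope n, Tendsto (fun t => J t n i) l (𝓝 (J' n i))) (j : V) (n : F) :
    Tendsto (fun t => M.varInfo (J t) j n) l (𝓝 (M.varInfo J' j n)) :=
  tendsto_const_nhds.add (tendsto_finsetSum _ fun k hk => h k j (mem_otherFactors.1 hk).1)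

theorem IsPSDInit.factorInfo_varInfo {J : M.FactorInfo} (hJ : M.IsPSDInit J) :
    M.IsPSDInit (M.factorInfo (M.varInfo J)) := fun n i _ =>
  hJ.isPosDefInfo_varInfo.posSemidef_factorInfo n i

theorem IsPSDInit.infoSeq {J₀ : M.FactorInfo} (hJ : M.IsPSDInit J₀) (l : ℕ) :
    M.IsPSDInit (M.infoSeq J₀ l) := by
  induction l with
  | zero => exact hJ
  | succ l ih => exact ih.factorInfo_varInfo

theorem exists_fixedPoint (M : LinearGaussianModel V F) :
    ∃ J : M.FactorInfo, M.IsPSDInit J ∧ M.factorInfo (M.varInfo J) = J := by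
  have hpsd := fun l => (isPSDInit_zero M).infoSeq l
  have hall : ∀ l n i, (M.infoSeq 0 l n i).PosSemidef := by
    rintro (_ | l) n i
    · exact PosSemidef.zero
    · exact (hpsd l).isPosDefInfo_varInfo.posSemidef_factorInfo n i
  have hstep : ∀ l n i x,
      (M.infoSeq 0 l n i).quadForm x ≤ (M.infoSeq 0 (l + 1) n i).quadForm x := by
    intro l
    induction l with
    | zero =>
      intro n i x
      have h0 : (M.infoSeq 0 0 n i).quadForm x = 0 := quadForm_zero x
      rw [h0]
      exact (hall 1 n i).quadForm_nonneg x
    | succ l ih =>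
      exact factorInfo_mono (hpsd l).isPosDefInfo_varInfo (hpsd (l + 1)).isPosDefInfo_varInfo
        (varInfo_mono fun n i _ => ih n i)
  have hlim : ∀ n i, ∃ B, Tendsto (fun l => M.infoSeq 0 l n i) atTop (𝓝 B) := by
    intro n i
    refine exists_tendsto_of_monotone (fun l => (hall l n i).isHermitian)
      (fun x => monotone_nat_of_le_succ fun l => hstep l n i x)
      ((M.A n i)ᵀ * (M.R n)⁻¹ * M.A n i) fun l x => (hstep l n i x).trans ?_
    exact M.factorInfo_le (hpsd l).isPosDefInfo_varInfo n i x
  choose J hJ using hlim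
  have hJpsd : M.IsPSDInit J := fun n i _ => by
    refine PosSemidef.of_dotProduct_mulVec_nonneg
      (isClosed_isHermitian.mem_of_tendsto (hJ n i)
        (Eventually.of_forall fun l => (hall l n i).isHermitian)) fun x => ?_
    exact ge_of_tendsto' (((continuous_quadForm x).tendsto _).comp (hJ n i))
      fun l => (hall l n i).quadForm_nonneg x
  refine ⟨J, hJpsd, funext fun n => funext fun i => ?_⟩
  exact tendsto_nhds_unique (tendsto_factorInfo hJpsd.isPosDefInfo_varInfo
    (tendsto_varInfo fun n i _ => hJ n i) n i).2 ((tendsto_add_atTop_iff_nat 1).2 (hJ n i))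

/-- The information matrices of the messages converge to any fixed point. -/
theorem tendsto_infoSeq [Fintype V] {J J₀ : M.FactorInfo} (hJ : M.IsPSDInit J)
    (hfix : M.factorInfo (M.varInfo J) = J) (hJ₀ : M.IsPSDInit J₀) (n : F) (i : V)
    (hi : i ∈ M.scope n) : Tendsto (fun l => M.infoSeq J₀ l n i) atTop (𝓝 (J n i)) := by
  have hK := hJ.isPosDefInfo_varInfo
  have hpd : ∀ n, ∀ i ∈ M.scope n, (J n i).PosDef := fun n i hi => by
    rw [← hfix]; exact hK.posDef_factorInfo hi
  -- the prior dominates a fixed fraction of the total information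
  obtain ⟨d, hd0, hd1, hd⟩ : ∃ d : ℝ, 0 < d ∧ d ≤ 1 ∧ ∀ j n x,
      d * (M.varInfo J j n).quadForm x ≤ (M.W j)⁻¹.quadForm x := by
    choose b hb0 hb using fun (j : V) (n : F) =>
      (M.posDef_W j).inv.exists_quadForm_le (M.varInfo J j n)
    set S := 1 + ∑ j, ∑ n, b j n
    have hS0 : 0 ≤ ∑ j, ∑ n, b j n :=
      Finset.sum_nonneg fun j _ => Finset.sum_nonneg fun n _ => hb0 j n
    have hS : ∀ j n, b j n ≤ S := fun j n => by
      have h1 := Finset.single_le_sum (f := fun n => b j n) (fun n _ => hb0 j n)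
        (Finset.mem_univ n)
      have h2 := Finset.single_le_sum (f := fun j => ∑ n, b j n)
        (fun j _ => Finset.sum_nonneg fun n _ => hb0 j n) (Finset.mem_univ j)
      linarith
    have hSpos : 0 < S := by linarith
    refine ⟨S⁻¹, inv_pos.2 hSpos, inv_le_one_of_one_le₀ (by linarith), fun j n x => ?_⟩
    rw [inv_mul_le_iff₀ hSpos]
    exact (hb j n x).trans (mul_le_mul_of_nonneg_right (hS j n)
      ((M.posDef_W j).inv.quadForm_nonneg x))
  have hlower : ∀ l : ℕ, ∀ n, ∀ i ∈ M.scope n, ∀ x,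
      (1 - (1 - d) ^ l) * (J n i).quadForm x ≤ (M.infoSeq J₀ l n i).quadForm x := by
    intro l
    induction l with
    | zero =>
      intro n i hi x
      simpa [LinearGaussianModel.infoSeq] using (hJ₀ n i hi).quadForm_nonneg x
    | succ l ih =>
      intro n i hi x
      have hp0 : 0 ≤ (1 - d) ^ l := pow_nonneg (by linarith) l
      have hp1 : (1 - d) ^ l ≤ 1 := pow_le_one₀ (by linarith) (by linarith)
      have hc0 : 0 < 1 - (1 - d) ^ (l + 1) := by rw [pow_succ]; nlinarith
      have hc1 : 1 - (1 - d) ^ (l + 1) ≤ 1 := by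
        linarith [pow_nonneg (by linarith : 0 ≤ 1 - d) (l + 1)]
      calc _ = (1 - (1 - d) ^ (l + 1)) * (M.factorInfo (M.varInfo J) n i).quadForm x := by
            rw [hfix]
        _ ≤ _ := le_factorInfo_smul hK hc0 hc1 n i x
        _ ≤ _ := factorInfo_mono (hK.smul hc0) (hJ₀.infoSeq l).isPosDefInfo_varInfo
            (fun j n x => ?_) n i x
      have h1 := hd j n x
      rw [quadForm_smul, quadForm_varInfo (M.infoSeq J₀ l)]
      have h2 : (1 - (1 - d) ^ l) * ∑ k ∈ M.otherFactors j n, (J k j).quadForm x ≤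
          ∑ k ∈ M.otherFactors j n, (M.infoSeq J₀ l k j).quadForm x := by
        rw [Finset.mul_sum]
        exact Finset.sum_le_sum fun k hk => ih k j (mem_otherFactors.1 hk).1 x
      have h3 := quadForm_varInfo J j n x
      have h4 := mul_le_mul_of_nonneg_left h1 hp0
      rw [pow_succ]
      linear_combination h2 + h4 + (1 - (1 - d) ^ l) * h3
  obtain ⟨b, hb0, hb⟩ : ∃ b : ℝ, 0 ≤ b ∧ ∀ n, ∀ i ∈ M.scope n, ∀ x,
      (J₀ n i).quadForm x ≤ (1 + b) * (J n i).quadForm x := by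
    have : ∀ (n : F) (i : V), ∃ b : ℝ, 0 ≤ b ∧ (i ∈ M.scope n → ∀ x,
        (J₀ n i).quadForm x ≤ b * (J n i).quadForm x) := fun n i => by
      by_cases hi : i ∈ M.scope n
      · obtain ⟨b, hb0, hb⟩ := (hpd n i hi).exists_quadForm_le (J₀ n i)
        exact ⟨b, hb0, fun _ => hb⟩
      · exact ⟨0, le_rfl, fun h => absurd h hi⟩
    choose b hb0 hb using this
    refine ⟨∑ n, ∑ i, b n i, Finset.sum_nonneg fun n _ => Finset.sum_nonneg fun i _ => hb0 n i,
      fun n i hi x => (hb n i hi x).trans (mul_le_mul_of_nonneg_right ?_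
        ((hpd n i hi).quadForm_nonneg x))⟩
    have h1 := Finset.single_le_sum (f := fun i => b n i) (fun i _ => hb0 n i)
      (Finset.mem_univ i)
    have h2 := Finset.single_le_sum (f := fun n => ∑ i, b n i)
      (fun n _ => Finset.sum_nonneg fun i _ => hb0 n i) (Finset.mem_univ n)
    linarith
  have hupper : ∀ l : ℕ, ∀ n, ∀ i ∈ M.scope n, ∀ x,
      (M.infoSeq J₀ l n i).quadForm x ≤ (1 + b * (1 - d) ^ l) * (J n i).quadForm x := by
    intro l
    induction l with
    | zero =>
      intro n i hi x
      simpa [LinearGaussianModel.infoSeq] using hb n i hi x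
    | succ l ih =>
      intro n i hi x
      have hp0 : 0 ≤ b * (1 - d) ^ l := mul_nonneg hb0 (pow_nonneg (by linarith) l)
      have hc1 : 1 ≤ 1 + b * (1 - d) ^ (l + 1) := by
        linarith [mul_nonneg hb0 (pow_nonneg (by linarith : 0 ≤ 1 - d) (l + 1))]
      have hc0 : 0 < 1 + b * (1 - d) ^ (l + 1) := by linarith
      calc _ ≤ _ := factorInfo_mono (hJ₀.infoSeq l).isPosDefInfo_varInfo (hK.smul hc0)
            (fun j n x => ?_) n i x
        _ ≤ _ := factorInfo_smul_le hK hc1 n i x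
        _ = _ := by rw [hfix]
      have h1 := hd j n x
      rw [quadForm_smul, quadForm_varInfo (M.infoSeq J₀ l)]
      have h2 : ∑ k ∈ M.otherFactors j n, (M.infoSeq J₀ l k j).quadForm x ≤
          (1 + b * (1 - d) ^ l) * ∑ k ∈ M.otherFactors j n, (J k j).quadForm x := by
        rw [Finset.mul_sum]
        exact Finset.sum_le_sum fun k hk => ih k j (mem_otherFactors.1 hk).1 x
      have h3 := quadForm_varInfo J j n x
      have h4 := mul_le_mul_of_nonneg_left h1 hp0
      rw [pow_succ]
      linear_combination h2 + h4 - (1 + b * (1 - d) ^ l) * h3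
  refine tendsto_of_quadForm
    (Eventually.of_forall fun l => (hJ₀.infoSeq l n i hi).isHermitian) (hJ n i hi).isHermitian
    fun x => ?_
  have hpow := tendsto_pow_atTop_nhds_zero_of_lt_one (by linarith : 0 ≤ 1 - d) (by linarith)
  refine tendsto_of_tendsto_of_tendsto_of_le_of_le
    (g := fun l : ℕ => (1 - (1 - d) ^ l) * (J n i).quadForm x)
    (h := fun l : ℕ => (1 + b * (1 - d) ^ l) * (J n i).quadForm x) ?_ ?_
    (fun l => hlower l n i hi x) (fun l => hupper l n i hi x)
  · simpa using (hpow.const_sub 1).mul_const ((J n i).quadForm x)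
  · simpa using ((hpow.const_mul b).const_add 1).mul_const ((J n i).quadForm x)

end LinearGaussianModel

theorem Relation.ReflTransGen.exists_seq {α : Type*} {r : α → α → Prop} {a b : α}
    (h : Relation.ReflTransGen r a b) :
    ∃ (n : ℕ) (f : ℕ → α), f 0 = a ∧ f n = b ∧ ∀ t < n, r (f t) (f (t + 1)) := by
  induction h with
  | refl => exact ⟨0, fun _ => a, rfl, rfl, by simp⟩
  | @tail b c _ hbc ih =>
    obtain ⟨n, f, h0, hn, hf⟩ := ih
    refine ⟨n + 1, fun t => if t ≤ n then f t else c, by simpa using h0, by simp, fun t ht => ?_⟩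
    rcases Nat.lt_succ_iff_lt_or_eq.1 ht with h | rfl
    · simpa [h.le, Nat.succ_le_of_lt h] using hf t h
    · simpa [hn] using hbc

/-- An element that is related to itself by the transitive closure is visited infinitely often by
some infinite chain. -/
theorem Relation.TransGen.exists_recurrent_seq {α : Type*} {r : α → α → Prop} {a : α}
    (h : Relation.TransGen r a a) :
    ∃ f : ℕ → α, (∀ t, r (f t) (f (t + 1))) ∧ ∀ T, ∃ t ≥ T, f t = a := by
  obtain ⟨b, hab, hba⟩ := Relation.TransGen.head'_iff.1 h
  obtain ⟨n, f, h0, hn, hf⟩ := hba.exists_seq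
  refine ⟨fun t => if t % (n + 1) = 0 then a else f (t % (n + 1) - 1), fun t => ?_,
    fun T => ⟨T * (n + 1), by nlinarith, by simp⟩⟩
  have hlt := Nat.mod_lt t (Nat.succ_pos n)
  have hmod : (t + 1) % (n + 1) = if t % (n + 1) = n then 0 else t % (n + 1) + 1 := by
    rw [← Nat.mod_add_mod]
    split_ifs with h
    · rw [h, Nat.mod_self]
    · exact Nat.mod_eq_of_lt (by simp only [Nat.succ_eq_add_one] at hlt; omega)
  simp only [hmod]
  generalize t % (n + 1) = s at *
  rcases s with _ | s
  · rcases n with _ | n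
    · simpa [← hn, h0] using hab
    · simpa [h0] using hab
  · by_cases hs : s + 1 = n
    · subst hs
      simpa [hn] using hf s (by omega)
    · simpa [hs] using hf s (by omega)

namespace SimpleGraph

variable {X : Type*} {G : SimpleGraph X}

theorem exists_walk_of_seq (x : ℕ → X) (n : ℕ) (h : ∀ t < n, G.Adj (x t) (x (t + 1))) :
    ∃ w : G.Walk (x 0) (x n), w.edges = (List.range n).map fun t => s(x t, x (t + 1)) := by
  induction n with
  | zero => exact ⟨Walk.nil, rfl⟩
  | succ n ih =>
    obtain ⟨w, hw⟩ := ih fun t ht => h t (by omega)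
    exact ⟨w.concat (h n (by omega)), by simp [Walk.edges_concat, hw, List.range_succ]⟩

/-- In an acyclic graph, sequences that never turn back trace out paths. -/
theorem IsAcyclic.exists_isPath_of_seq (hG : G.IsAcyclic) (x : ℕ → X) (n : ℕ)
    (h : ∀ t < n, G.Adj (x t) (x (t + 1))) (hx : ∀ t, x (t + 2) ≠ x t) :
    ∃ w : G.Walk (x 0) (x n), w.IsPath ∧
      w.edges = (List.range n).map fun t => s(x t, x (t + 1)) := by
  obtain ⟨w, hw⟩ := exists_walk_of_seq x n h
  refine ⟨w, (hG.isPath_iff_isChain w).2 ?_, hw⟩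
  rw [hw, List.isChain_map, List.isChain_iff_getElem]
  intro i hi
  simp only [List.getElem_range, ne_eq, Sym2.eq_iff, not_or, not_and]
  exact ⟨fun _ h2 => hx i (by simpa [add_assoc] using h2.symm ▸ ‹x i = x (i + 1)›.symm),
    fun h1 => absurd h1.symm (hx i)⟩

/-- In a finite graph whose cycles all have the same edges, a sequence that never turns back
ends up in the loop. -/
theorem eventually_mem_cycle_of_seq [Finite X] {u : X} {c : G.Walk u u} (hc : c.IsCycle)
    (huniq : ∀ (w : X) (c' : G.Walk w w), c'.IsCycle → ∀ e : Sym2 X, e ∈ c'.edges ↔ e ∈ c.edges)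
    (x : ℕ → X) (hadj : ∀ t, G.Adj (x t) (x (t + 1))) (hx : ∀ t, x (t + 2) ≠ x t) :
    ∃ T, ∀ t ≥ T, s(x t, x (t + 1)) ∈ c.edges := by
  classical
  have := Fintype.ofFinite X
  obtain ⟨e, he⟩ : ∃ e, e ∈ c.edges := by
    apply List.exists_mem_of_ne_nil
    intro h
    exact hc.not_nil (by simpa using h)
  have hacyc : (G.deleteEdges {e}).IsAcyclic := by
    intro v p hp
    have h1 := (huniq v (p.mapLe (deleteEdges_le _)) (hp.mapLe _) e).2 he
    rw [Walk.edges_mapLe_eq_edges] at h1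
    simpa using p.edges_subset_edgeSet h1
  have hpath : ∀ s n, (∀ t < n, s(x (s + t), x (s + t + 1)) ≠ e) →
      ∃ w : (G.deleteEdges {e}).Walk (x s) (x (s + n)), w.IsPath ∧
        w.edges = (List.range n).map fun t => s(x (s + t), x (s + t + 1)) := by
    intro s n h
    exact hacyc.exists_isPath_of_seq (fun t => x (s + t)) n
      (fun t ht => by
        rw [deleteEdges_adj]
        exact ⟨hadj _, by simpa [add_assoc] using h t ht⟩) fun t => hx (s + t)
  have hoccur : ∀ s, ∃ t ≥ s, s(x t, x (t + 1)) = e := by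
    intro s
    by_contra! hcon
    obtain ⟨w, hw, hwe⟩ := hpath s (Fintype.card X) fun t _ => hcon _ (by omega)
    have h1 := hw.length_lt
    rw [← Walk.length_edges, hwe] at h1
    simp at h1
  obtain ⟨T, -, hT⟩ := hoccur 0
  refine ⟨T, fun t ht => ?_⟩
  by_cases hte : s(x t, x (t + 1)) = e
  · rwa [hte]
  set P : ℕ → Prop := fun r => s(x r, x (r + 1)) = e
  have h1 : P (Nat.findGreatest P t) := Nat.findGreatest_spec ht hT
  have h1le : Nat.findGreatest P t ≤ t := Nat.findGreatest_le t
  have h1max : ∀ r, Nat.findGreatest P t < r → r ≤ t → ¬ P r := fun r hr hrt =>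
    Nat.findGreatest_is_greatest hr hrt
  generalize Nat.findGreatest P t = a at *
  have hat : a < t := lt_of_le_of_ne h1le (by rintro rfl; exact hte h1)
  have h2 := Nat.find_spec (hoccur t)
  have h2min : ∀ r, t ≤ r → r < Nat.find (hoccur t) → ¬ P r := fun r hr hrt hP =>
    Nat.find_min (hoccur t) hrt ⟨hr, hP⟩
  generalize Nat.find (hoccur t) = b at *
  have htb : t < b := lt_of_le_of_ne h2.1 (by rintro rfl; exact hte h2.2)
  obtain ⟨n, rfl⟩ : ∃ n, b = a + 1 + n := ⟨b - (a + 1), by omega⟩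
  obtain ⟨w, hw, hwe⟩ := hpath (a + 1) n fun r hr => by
    rcases le_or_gt (a + 1 + r) t with h | h
    · exact h1max _ (by omega) h
    · exact h2min _ h.le (by omega)
  have heq := h1.trans h2.2.symm
  rw [Sym2.eq_iff] at heq
  rcases heq with ⟨h3, -⟩ | ⟨-, h3⟩
  · have hw' : (w.mapLe (deleteEdges_le _) : G.Walk _ _).IsPath := hw.mapLe _
    have hcyc : (Walk.cons (hadj a) ((w.mapLe (deleteEdges_le _)).copy rfl h3.symm)).IsCycle := by
      rw [Walk.cons_isCycle_iff]
      refine ⟨by simpa using hw', ?_⟩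
      rw [Walk.edges_copy, Walk.edges_mapLe_eq_edges, h1]
      intro h4
      simpa using w.edges_subset_edgeSet h4
    refine (huniq _ _ hcyc _).1 ?_
    rw [Walk.edges_cons, Walk.edges_copy, Walk.edges_mapLe_eq_edges, hwe]
    refine List.mem_cons_of_mem _ (List.mem_map.2 ⟨t - (a + 1), ?_, ?_⟩)
    · simp only [List.mem_range]; omega
    · rw [show a + 1 + (t - (a + 1)) = t by omega]
  · exfalso
    have h4 : (w.copy rfl h3.symm).IsPath := (Walk.isPath_copy w rfl h3.symm).2 hw
    have h5 := Walk.length_eq_zero_iff.2 (Walk.isPath_iff_nil.1 h4)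
    rw [Walk.length_copy, ← Walk.length_edges, hwe] at h5
    simp at h5
    omega

/-- The directed edge `e` can be followed by the directed edge `d` on a walk that does not turn
back. -/
def PrecededBy (G : SimpleGraph X) (d e : X × X) : Prop :=
  e.2 = d.1 ∧ G.Adj e.1 e.2 ∧ e.1 ≠ d.2

theorem mem_cycle_of_transGen [Finite X] {u : X} {c : G.Walk u u} (hc : c.IsCycle)
    (huniq : ∀ (w : X) (c' : G.Walk w w), c'.IsCycle → ∀ e : Sym2 X, e ∈ c'.edges ↔ e ∈ c.edges)
    {d : X × X} (hd : Relation.TransGen G.PrecededBy d d) : s(d.1, d.2) ∈ c.edges := by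
  obtain ⟨f, hf, hrec⟩ := hd.exists_recurrent_seq
  obtain ⟨T, hT⟩ := eventually_mem_cycle_of_seq hc huniq (fun t => (f (t + 1)).2)
    (fun t => by
      have h := hf (t + 1)
      simp only [h.1]
      exact (hf t).2.1.symm)
    (fun t => by
      have h := hf (t + 1)
      rw [(hf (t + 2)).1]
      exact h.2.2)
  obtain ⟨t, ht, rfl⟩ := hrec (T + 1)
  obtain ⟨t, rfl⟩ : ∃ s, t = s + 1 := ⟨t - 1, by omega⟩
  have h := hT t (by omega)
  rw [(hf (t + 1)).1] at h
  rwa [Sym2.eq_swap]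

/-- In a graph that is the union of a single loop and a forest, the directed edges have weights
such that the total weight of the directed edges that precede a given one, without turning back,
exceeds its own weight by an arbitrarily small factor only. -/
theorem exists_weight [Finite X] (hG : IsSingleLoopWithForest G) {ε : ℝ} (hε : 0 < ε) :
    ∃ w : X → X → ℝ, (∀ a b, 0 < w a b) ∧ ∀ a b (S : Finset X),
      (∀ c ∈ S, G.Adj c a ∧ c ≠ b) → ∑ c ∈ S, w c a ≤ (1 + ε) * w a b := by
  classical
  have := Fintype.ofFinite X
  obtain ⟨u, c, hc, huniq⟩ := hG
  let reach : X × X → Finset (X × X) := fun d =>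
    Finset.univ.filter (Relation.ReflTransGen G.PrecededBy d)
  have hsub : ∀ {d e}, G.PrecededBy d e → reach e ⊆ reach d := fun {d e} h z hz => by
    simp only [reach, Finset.mem_filter, Finset.mem_univ, true_and] at hz ⊢
    exact Relation.ReflTransGen.head h hz
  have hrec : ∀ {d e}, G.PrecededBy d e → (reach d).card ≤ (reach e).card →
      s(d.1, d.2) ∈ c.edges ∧ s(e.1, e.2) ∈ c.edges := fun {d e} h hcard => by
    have heq := Finset.eq_of_subset_of_card_le (hsub h) hcard
    have hed : Relation.ReflTransGen G.PrecededBy e d := by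
      have : d ∈ reach e := by
        rw [heq]
        simp [reach, Relation.ReflTransGen.refl]
      simpa [reach] using this
    exact ⟨mem_cycle_of_transGen hc huniq (Relation.TransGen.head' h hed),
      mem_cycle_of_transGen hc huniq (Relation.TransGen.tail' hed h)⟩
  set L : ℝ := 1 + Fintype.card X / ε
  have hL1 : 1 ≤ L := le_add_of_nonneg_right (by positivity)
  have hL0 : 0 < L := by linarith
  have hL : Fintype.card X ≤ ε * L := by
    have : ε * L = ε + Fintype.card X := by simp only [L]; field_simp
    linarith
  refine ⟨fun a b => L ^ (reach (a, b)).card, fun a b => pow_pos hL0 _, fun a b S hS => ?_⟩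
  have hprec : ∀ z ∈ S, G.PrecededBy (a, b) (z, a) := fun z hz => ⟨rfl, hS z hz⟩
  rw [← Finset.sum_filter_add_sum_filter_not S
    fun z => (reach (a, b)).card ≤ (reach (z, a)).card, add_mul, one_mul]
  refine add_le_add ?_ ?_
  · have hcard : (S.filter fun z => (reach (a, b)).card ≤ (reach (z, a)).card).card ≤ 1 := by
      refine Finset.card_le_one.2 fun z hz z' hz' => ?_
      rw [Finset.mem_filter] at hz hz'
      obtain ⟨h1, h2⟩ := hrec (hprec z hz.1) hz.2
      obtain ⟨-, h3⟩ := hrec (hprec z' hz'.1) hz'.2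
      have hn := hc.ncard_neighborSet_toSubgraph_eq_two (c.fst_mem_support_of_mem_edges h1)
      by_contra hne
      have hthree : ({b, z, z'} : Set X) ⊆ c.toSubgraph.neighborSet a := by
        rintro y (rfl | rfl | rfl)
        · simpa [Walk.adj_toSubgraph_iff_mem_edges] using h1
        · rw [Sym2.eq_swap] at h2
          simpa [Walk.adj_toSubgraph_iff_mem_edges] using h2
        · rw [Sym2.eq_swap] at h3
          simpa [Walk.adj_toSubgraph_iff_mem_edges] using h3
      have h4 := Set.ncard_le_ncard hthree (Set.toFinite _)
      rw [hn, Set.ncard_eq_three.2 ⟨b, z, z', (hS z hz.1).2.symm, (hS z' hz'.1).2.symm, hne, rfl⟩]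
        at h4
      omega
    calc _ ≤ ∑ z ∈ S.filter fun z => (reach (a, b)).card ≤ (reach (z, a)).card,
          L ^ (reach (a, b)).card := Finset.sum_le_sum fun z hz =>
            pow_le_pow_right₀ hL1
              (Finset.card_le_card (hsub (hprec z (Finset.mem_filter.1 hz).1)))
      _ ≤ _ := by
        rw [Finset.sum_const, nsmul_eq_mul]
        exact mul_le_of_le_one_left (pow_pos hL0 _).le (by exact_mod_cast hcard)
  · calc _ ≤ ∑ z ∈ S.filter fun z => ¬ (reach (a, b)).card ≤ (reach (z, a)).card,
          L ^ (reach (a, b)).card / L := Finset.sum_le_sum fun z hz => by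
            rw [le_div_iff₀ hL0, ← pow_succ]
            exact pow_le_pow_right₀ hL1 (not_le.1 (Finset.mem_filter.1 hz).2)
      _ ≤ Fintype.card X * (L ^ (reach (a, b)).card / L) := by
        rw [Finset.sum_const, nsmul_eq_mul]
        have := Finset.card_le_univ (S.filter fun z => ¬ (reach (a, b)).card ≤ (reach (z, a)).card)
        gcongr
      _ ≤ _ := by
        rw [mul_div_assoc', div_le_iff₀ hL0]
        nlinarith [pow_pos hL0 (reach (a, b)).card]

end SimpleGraph

/-- Perturbations that tend to zero do not destroy the convergence to zero of a contractive
recursion. -/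
theorem tendsto_zero_of_affine_recursion {T s : ℕ → ℝ} {ρ : ℝ} (hρ0 : 0 ≤ ρ) (hρ1 : ρ < 1)
    (hT0 : ∀ l, 0 ≤ T l) (hT : ∀ l, T (l + 1) ≤ ρ * T l + s l) (hs : Tendsto s atTop (𝓝 0)) :
    Tendsto T atTop (𝓝 0) := by
  rw [Metric.tendsto_atTop]
  intro ε hε
  have hd : 0 < ε / 2 * (1 - ρ) := mul_pos (by linarith) (by linarith)
  obtain ⟨N, hN⟩ := eventually_atTop.1 (hs.eventually_lt_const hd)
  have hbound : ∀ k, T (N + k) ≤ ρ ^ k * T N + ε / 2 := by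
    intro k
    induction k with
    | zero => simp; linarith
    | succ k ih =>
      have h1 := hT (N + k)
      have h2 := hN (N + k) (by omega)
      have h3 := mul_le_mul_of_nonneg_left ih hρ0
      rw [← add_assoc, pow_succ]
      linarith
  have hlim : Tendsto (fun k => ρ ^ k * T N) atTop (𝓝 0) := by
    simpa using (tendsto_pow_atTop_nhds_zero_of_lt_one hρ0 hρ1).mul_const (T N)
  obtain ⟨K, hK⟩ := eventually_atTop.1 (hlim.eventually_lt_const (by linarith : 0 < ε / 2))
  refine ⟨N + K, fun l hl => ?_⟩
  obtain ⟨k, rfl⟩ : ∃ k, l = N + k := ⟨l - N, by omega⟩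
  rw [Real.dist_eq, sub_zero, abs_of_nonneg (hT0 _)]
  linarith [hbound k, hK k (by omega)]

namespace LinearGaussianModel

open Matrix

variable {V F : Type*} {M : LinearGaussianModel V F}

/-- The vectors `h n i` are bounded by `T * w n i`, in the norms dual to the seminorms given by
the information matrices `J n i`. -/
def IsDualBound (w : F → V → ℝ) (J : M.FactorInfo) (h : M.FactorMean) (T : ℝ) : Prop :=
  ∀ n, ∀ i ∈ M.scope n, ∀ x, |h n i ⬝ᵥ x| ≤ T * w n i * √((J n i).quadForm x)

theorem IsDualBound.add {w : F → V → ℝ} {J : M.FactorInfo} {h h' : M.FactorMean} {T T' : ℝ}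
    (hT : IsDualBound w J h T) (hT' : IsDualBound w J h' T') :
    IsDualBound w J (h + h') (T + T') := fun n i hi x => by
  calc |(h n i + h' n i) ⬝ᵥ x| ≤ |h n i ⬝ᵥ x| + |h' n i ⬝ᵥ x| := by
        rw [add_dotProduct]; exact abs_add_le _ _
    _ ≤ _ := by
        rw [add_mul, add_mul]
        exact add_le_add (hT n i hi x) (hT' n i hi x)

theorem IsDualBound.neg {w : F → V → ℝ} {J : M.FactorInfo} {h : M.FactorMean} {T : ℝ}
    (hT : IsDualBound w J h T) : IsDualBound w J (-h) T := fun n i hi x => by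
  simpa using hT n i hi x

/-- The weighted sum of the norms dual to the norms given by the information matrices. -/
noncomputable def dualNorm [Fintype F] (w : F → V → ℝ) (J : M.FactorInfo) (h : M.FactorMean) :
    ℝ :=
  ∑ n, ∑ i ∈ M.scope n, √((J n i)⁻¹.quadForm (h n i)) / w n i

theorem dualNorm_nonneg [Fintype F] {w : F → V → ℝ} (hw : ∀ n i, 0 < w n i)
    (J : M.FactorInfo) (h : M.FactorMean) : 0 ≤ dualNorm w J h :=
  Finset.sum_nonneg fun n _ => Finset.sum_nonneg fun i _ =>
    div_nonneg (Real.sqrt_nonneg _) (hw n i).le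

theorem isDualBound_dualNorm [Fintype F] {w : F → V → ℝ} (hw : ∀ n i, 0 < w n i)
    {J : M.FactorInfo} (hJ : ∀ n, ∀ i ∈ M.scope n, (J n i).PosDef)
    (h : M.FactorMean) : IsDualBound w J h (dualNorm w J h) := fun n i hi x => by
  have hterm : ∀ n i, 0 ≤ √((J n i)⁻¹.quadForm (h n i)) / w n i := fun n i =>
    div_nonneg (Real.sqrt_nonneg _) (hw n i).le
  have h1 : √((J n i)⁻¹.quadForm (h n i)) / w n i ≤ dualNorm w J h :=
    (Finset.single_le_sum (f := fun i => √((J n i)⁻¹.quadForm (h n i)) / w n i)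
      (fun i _ => hterm n i) hi).trans
    (Finset.single_le_sum (f := fun n => ∑ i ∈ M.scope n, √((J n i)⁻¹.quadForm (h n i)) / w n i)
      (fun n _ => Finset.sum_nonneg fun i _ => hterm n i) (Finset.mem_univ n))
  rw [div_le_iff₀ (hw n i)] at h1
  refine le_trans ?_ (mul_le_mul_of_nonneg_right h1 (Real.sqrt_nonneg _))
  rw [← Real.sqrt_mul ((hJ n i hi).inv.quadForm_nonneg _)]
  exact Real.abs_le_sqrt ((hJ n i hi).sq_dotProduct_le _ _)

theorem tendsto_dualNorm_zero [Fintype F] (w : F → V → ℝ) {J : ℕ → M.FactorInfo}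
    {J' : M.FactorInfo}
    (hJ' : ∀ n, ∀ i ∈ M.scope n, (J' n i).PosDef)
    (hJ : ∀ n, ∀ i ∈ M.scope n, Tendsto (fun l => J l n i) atTop (𝓝 (J' n i)))
    {h : ℕ → M.FactorMean}
    (hh : ∀ n, ∀ i ∈ M.scope n, Tendsto (fun l => h l n i) atTop (𝓝 0)) :
    Tendsto (fun l => dualNorm w (J l) (h l)) atTop (𝓝 0) := by
  have : (0 : ℝ) = ∑ n, ∑ i ∈ M.scope n, √((J' n i)⁻¹.quadForm 0) / w n i := by
    simp [quadForm]
  rw [this]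
  refine tendsto_finsetSum _ fun n _ => tendsto_finsetSum _ fun i hi =>
    Tendsto.div_const (Tendsto.sqrt ?_) _
  have hcont : Continuous fun p : Matrix (Fin (M.dim i)) (Fin (M.dim i)) ℝ × (Fin (M.dim i) → ℝ)
      => p.1.quadForm p.2 := by unfold quadForm; fun_prop
  exact (hcont.tendsto _).comp (((hJ' n i hi).tendsto_inv (hJ n i hi)).prodMk_nhds (hh n i hi))

variable (M) in
/-- The information matrices are bounded by those of factors whose other variables are known. -/
def IsBoundedInfo (J : M.FactorInfo) : Prop :=
  ∀ n i x, (J n i).quadForm x ≤ ((M.A n i)ᵀ * (M.R n)⁻¹ * M.A n i).quadForm x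

theorem IsDualBound.tendsto_zero {w : F → V → ℝ} (hw : ∀ n i, 0 < w n i)
    {J : ℕ → M.FactorInfo}
    (hJ : ∀ l, M.IsBoundedInfo (J l)) {h : ℕ → M.FactorMean} {T : ℕ → ℝ} (hT0 : ∀ l, 0 ≤ T l)
    (hh : ∀ l, IsDualBound w (J l) (h l) (T l)) (hT : Tendsto T atTop (𝓝 0)) {n : F} {i : V}
    (hi : i ∈ M.scope n) : Tendsto (fun l => h l n i) atTop (𝓝 0) := by
  refine tendsto_pi_nhds.2 fun a => ?_
  set C := w n i *
    √(((M.A n i)ᵀ * (M.R n)⁻¹ * M.A n i).quadForm (Pi.single a 1))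
  refine squeeze_zero_norm (a := fun l => T l * C) (fun l => ?_) (by simpa using hT.mul_const C)
  have h1 := hh l n i hi (Pi.single a 1)
  rw [dotProduct_single_one, mul_assoc] at h1
  exact h1.trans (mul_le_mul_of_nonneg_left (mul_le_mul_of_nonneg_left
    (Real.sqrt_le_sqrt (hJ l n i _)) (hw n i).le) (hT0 l))

variable [DecidableEq V] [Fintype F] [DecidableEq F]

/-- The linear map that describes how one round of belief propagation acts on the information
vectors `J n i *ᵥ v n i`, up to sign and a constant. -/
noncomputable def infoVecMap (K : M.VarInfo) : M.FactorMean →ₗ[ℝ] M.FactorMean where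
  toFun h := fun n i => (M.A n i)ᵀ *ᵥ (M.residualCov K n i)⁻¹ *ᵥ
    ∑ j ∈ (M.scope n).erase i, M.A n j *ᵥ (K j n)⁻¹ *ᵥ ∑ k ∈ M.otherFactors j n, h k j
  map_add' h h' := by
    funext n i
    simp only [Pi.add_apply, Finset.sum_add_distrib, mulVec_add]
  map_smul' c h := by
    funext n i
    simp only [Pi.smul_apply, RingHom.id_apply, ← Finset.smul_sum, mulVec_smul]

theorem infoVecMap_apply (K : M.VarInfo) (h : M.FactorMean) (n : F) (i : V) :
    infoVecMap K h n i = (M.A n i)ᵀ *ᵥ (M.residualCov K n i)⁻¹ *ᵥ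
      ∑ j ∈ (M.scope n).erase i, M.A n j *ᵥ (K j n)⁻¹ *ᵥ ∑ k ∈ M.otherFactors j n, h k j := rfl

theorem infoVecMap_congr (K : M.VarInfo) {h h' : M.FactorMean}
    (hh : ∀ n, ∀ i ∈ M.scope n, h n i = h' n i) : infoVecMap K h = infoVecMap K h' := by
  funext n i
  rw [infoVecMap_apply, infoVecMap_apply]
  congr 2
  refine Finset.sum_congr rfl fun j _ => ?_
  rw [Finset.sum_congr rfl fun k hk => hh k j (mem_otherFactors.1 hk).1]

/-- The constant term of the action of one round of belief propagation on the information
vectors. -/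
noncomputable def infoVecConst (y : (n : F) → (Fin (M.obs n) → ℝ)) (K : M.VarInfo) :
    M.FactorMean := fun n i => (M.A n i)ᵀ *ᵥ (M.residualCov K n i)⁻¹ *ᵥ y n

theorem factorInfo_mulVec_factorMean (y : (n : F) → (Fin (M.obs n) → ℝ)) {J : M.FactorInfo}
    (hJ : M.IsPSDInit J) (v : M.FactorMean) {n : F} {i : V} (hi : i ∈ M.scope n) :
    M.factorInfo (M.varInfo J) n i *ᵥ M.factorMean y (M.varInfo J) (M.varMean J v) n i =
      infoVecConst y (M.varInfo J) n i -
        infoVecMap (M.varInfo J) (fun n i => J n i *ᵥ v n i) n i := by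
  have hpd := hJ.isPosDefInfo_varInfo.posDef_factorInfo hi
  simp only [factorMean, infoVecConst, infoVecMap_apply, varMean]
  rw [Matrix.mul_assoc, ← mulVec_mulVec, hpd.mulVec_inv_mulVec, ← mulVec_mulVec, mulVec_sub,
    mulVec_sub]

theorem abs_infoVecMap_dotProduct_le {J : M.FactorInfo} (hJ : M.IsPSDInit J) {c : ℝ}
    (hc : ∀ j n x, ∀ k ∈ M.otherFactors j n,
      (J k j).quadForm x ≤ c ^ 2 * (M.varInfo J j n).quadForm x) (hc0 : 0 ≤ c)
    {t : F → V → ℝ} (ht : ∀ n i, 0 ≤ t n i) {h : M.FactorMean}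
    (hh : ∀ n, ∀ i ∈ M.scope n, ∀ x, |h n i ⬝ᵥ x| ≤ t n i * √((J n i).quadForm x))
    (n : F) (i : V) (x : Fin (M.dim i) → ℝ) :
    |infoVecMap (M.varInfo J) h n i ⬝ᵥ x| ≤
      (c * ∑ j ∈ (M.scope n).erase i, ∑ k ∈ M.otherFactors j n, t k j) *
        √((M.factorInfo (M.varInfo J) n i).quadForm x) := by
  have hK := hJ.isPosDefInfo_varInfo
  set K := M.varInfo J
  have hC := hK.posDef_residualCov n i
  set z := (M.residualCov K n i)⁻¹ *ᵥ M.A n i *ᵥ x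
  have hexp : infoVecMap K h n i ⬝ᵥ x = ∑ j ∈ (M.scope n).erase i,
      ∑ k ∈ M.otherFactors j n, h k j ⬝ᵥ ((K j n)⁻¹ *ᵥ (M.A n j)ᵀ *ᵥ z) := by
    rw [infoVecMap_apply, mulVec_transpose, ← dotProduct_mulVec,
      hC.inv.isHermitian.mulVec_dotProduct, sum_dotProduct]
    refine Finset.sum_congr rfl fun j _ => ?_
    rw [← sum_dotProduct, ← (hK j n).inv.isHermitian.mulVec_dotProduct, mulVec_transpose,
      dotProduct_comm, dotProduct_mulVec, dotProduct_comm]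
  rw [hexp]
  refine (Finset.abs_sum_le_sum_abs _ _).trans ?_
  rw [Finset.mul_sum, Finset.sum_mul]
  refine Finset.sum_le_sum fun j hj => (Finset.abs_sum_le_sum_abs _ _).trans ?_
  rw [Finset.mul_sum, Finset.sum_mul]
  refine Finset.sum_le_sum fun k hk => ?_
  refine (hh k j (mem_otherFactors.1 hk).1 _).trans ?_
  rw [mul_comm c, mul_assoc]
  refine mul_le_mul_of_nonneg_left ?_ (ht k j)
  rw [← Real.sqrt_sq hc0, ← Real.sqrt_mul (sq_nonneg c)]
  refine Real.sqrt_le_sqrt ((hc j n _ k hk).trans (mul_le_mul_of_nonneg_left ?_ (sq_nonneg c)))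
  rw [← (hK j n).quadForm_inv, quadForm_factorInfo, hC.quadForm_inv, quadForm_residualCov]
  have h1 := Finset.single_le_sum (f := fun j => (K j n)⁻¹.quadForm ((M.A n j)ᵀ *ᵥ z))
    (fun j _ => (hK j n).inv.quadForm_nonneg _) hj
  linarith [(M.posDef_R n).quadForm_nonneg z]

theorem exists_quadForm_le_varInfo [Fintype V] (M : LinearGaussianModel V F) :
    ∃ c : ℝ, 0 ≤ c ∧ c < 1 ∧ ∀ J, M.IsPSDInit J → M.IsBoundedInfo J → ∀ j n x,
      ∀ k ∈ M.otherFactors j n, (J k j).quadForm x ≤ c ^ 2 * (M.varInfo J j n).quadForm x := by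
  choose b hb0 hb using fun (k : F) (j : V) =>
    (M.posDef_W j).inv.exists_quadForm_le ((M.A k j)ᵀ * (M.R k)⁻¹ * M.A k j)
  set S := ∑ k, ∑ j, b k j
  have hS0 : 0 ≤ S := Finset.sum_nonneg fun j _ => Finset.sum_nonneg fun n _ => hb0 j n
  have hS : ∀ k j, b k j ≤ S := fun k j =>
    (Finset.single_le_sum (f := fun j => b k j) (fun j _ => hb0 k j)
      (Finset.mem_univ j)).trans (Finset.single_le_sum (f := fun k => ∑ j, b k j)
        (fun k _ => Finset.sum_nonneg fun j _ => hb0 k j) (Finset.mem_univ k))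
  refine ⟨√(S / (1 + S)), Real.sqrt_nonneg _, ?_, fun J hJ hJU j n x k hk => ?_⟩
  · rw [Real.sqrt_lt' one_pos, div_lt_iff₀ (by linarith)]
    linarith
  · rw [Real.sq_sqrt (by positivity), div_mul_eq_mul_div, le_div_iff₀ (by linarith),
      quadForm_varInfo]
    have h1 := Finset.single_le_sum (f := fun k => (J k j).quadForm x)
      (fun k hk => (hJ k j (mem_otherFactors.1 hk).1).quadForm_nonneg x) hk
    have h2 := (hJU k j x).trans ((hb k j x).trans (mul_le_mul_of_nonneg_right (hS k j)
      ((M.posDef_W j).inv.quadForm_nonneg x)))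
    have h3 := mul_le_mul_of_nonneg_left h1 hS0
    linarith

/-- On a factor graph that is the union of a single loop and a forest, one round of belief
propagation contracts the information vectors, uniformly in the information matrices. -/
theorem exists_infoVecMap_contraction [Fintype V] (hM : IsSingleLoopWithForest M.factorGraph) :
    ∃ (w : F → V → ℝ) (ρ : ℝ), (∀ n i, 0 < w n i) ∧ 0 ≤ ρ ∧ ρ < 1 ∧
      ∀ J, M.IsPSDInit J → M.IsBoundedInfo J → ∀ (h : M.FactorMean) (T : ℝ), 0 ≤ T →
        IsDualBound w J h T →
        IsDualBound w (M.factorInfo (M.varInfo J)) (infoVecMap (M.varInfo J) h) (ρ * T) := by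
  obtain ⟨c, hc0, hc1, hc⟩ := exists_quadForm_le_varInfo M
  set ε := (1 - c) / 3
  have hε : 0 < ε := by simp only [ε]; linarith
  have hρ : c * (1 + ε) ^ 2 < 1 := by simp only [ε]; nlinarith [sq_nonneg (1 - c)]
  obtain ⟨w, hw0, hw⟩ := SimpleGraph.exists_weight hM hε
  refine ⟨fun n i => w (Sum.inr n) (Sum.inl i), c * (1 + ε) ^ 2, fun n i => hw0 _ _,
    by positivity, hρ, fun J hJ hJU h T hT hh n i hi x => ?_⟩
  refine (abs_infoVecMap_dotProduct_le hJ (hc J hJ hJU) hc0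
    (fun n i => mul_nonneg hT (hw0 _ _).le) hh n i x).trans
    (mul_le_mul_of_nonneg_right ?_ (Real.sqrt_nonneg _))
  have hvar : ∀ j, ∑ k ∈ M.otherFactors j n, w (Sum.inr k) (Sum.inl j) ≤
      (1 + ε) * w (Sum.inl j) (Sum.inr n) := fun j => by
    have := hw (Sum.inl j) (Sum.inr n) ((M.otherFactors j n).map Function.Embedding.inr) (by
      intro z hz
      obtain ⟨k, hk, rfl⟩ := Finset.mem_map.1 hz
      exact ⟨(mem_otherFactors.1 hk).1, fun h => (mem_otherFactors.1 hk).2 (Sum.inr_injective h)⟩)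
    simpa using this
  have hfac : ∑ j ∈ (M.scope n).erase i, w (Sum.inl j) (Sum.inr n) ≤
      (1 + ε) * w (Sum.inr n) (Sum.inl i) := by
    have := hw (Sum.inr n) (Sum.inl i) (((M.scope n).erase i).map Function.Embedding.inl) (by
      intro z hz
      obtain ⟨j, hj, rfl⟩ := Finset.mem_map.1 hz
      exact ⟨(Finset.mem_erase.1 hj).2, fun h => (Finset.mem_erase.1 hj).1 (Sum.inl_injective h)⟩)
    rwa [Finset.sum_map] at this
  simp only [← Finset.mul_sum]
  calc _ ≤ c * (T * ((1 + ε) * ((1 + ε) * w (Sum.inr n) (Sum.inl i)))) := by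
        refine mul_le_mul_of_nonneg_left (mul_le_mul_of_nonneg_left ?_ hT) hc0
        refine (Finset.sum_le_sum fun j _ => hvar j).trans ?_
        rw [← Finset.mul_sum]
        exact mul_le_mul_of_nonneg_left hfac (by linarith)
    _ = _ := by ring

theorem IsPSDInit.isBoundedInfo_factorInfo {J : M.FactorInfo} (hJ : M.IsPSDInit J) :
    M.IsBoundedInfo (M.factorInfo (M.varInfo J)) := fun n i x =>
  M.factorInfo_le hJ.isPosDefInfo_varInfo n i x

/-- The limiting affine recursion of the information vectors has a fixed point. -/
theorem exists_infoVec_fixedPoint [Fintype V] (hM : IsSingleLoopWithForest M.factorGraph)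
    {J : M.FactorInfo} (hJ : M.IsPSDInit J) (hfix : M.factorInfo (M.varInfo J) = J)
    (g : M.FactorMean) : ∃ h : M.FactorMean, h = g - infoVecMap (M.varInfo J) h := by
  obtain ⟨w, ρ, hw, hρ0, hρ1, hcon⟩ := exists_infoVecMap_contraction hM
  have hpd : ∀ n, ∀ i ∈ M.scope n, (J n i).PosDef := fun n i hi => by
    rw [← hfix]; exact hJ.isPosDefInfo_varInfo.posDef_factorInfo hi
  have hbd : M.IsBoundedInfo J := by
    rw [← hfix]; exact hJ.isBoundedInfo_factorInfo
  set B := infoVecMap (M.varInfo J)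
  have hinj : Function.Injective (LinearMap.id + B : M.FactorMean →ₗ[ℝ] M.FactorMean) := by
    rw [← LinearMap.ker_eq_bot, LinearMap.ker_eq_bot']
    intro h hh
    have hh' : h = -B h := eq_neg_of_add_eq_zero_left hh
    have hpow : ∀ l : ℕ, IsDualBound w J h (ρ ^ l * dualNorm w J h) := by
      intro l
      induction l with
      | zero => simpa using isDualBound_dualNorm hw hpd h
      | succ l ih =>
        have := (hcon J hJ hbd h _
          (mul_nonneg (pow_nonneg hρ0 l) (dualNorm_nonneg hw J h)) ih).neg
        rw [hfix, ← hh'] at this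
        rwa [pow_succ', mul_assoc]
    have hzero : ∀ n, ∀ i ∈ M.scope n, h n i = 0 := fun n i hi =>
      tendsto_nhds_unique tendsto_const_nhds (IsDualBound.tendsto_zero hw (J := fun _ => J)
        (fun _ => hbd) (fun l => mul_nonneg (pow_nonneg hρ0 l) (dualNorm_nonneg hw J h)) hpow
        (by simpa using (tendsto_pow_atTop_nhds_zero_of_lt_one hρ0 hρ1).mul_const
              (dualNorm w J h)) hi)
    have h0 : B h = B 0 := infoVecMap_congr _ hzero
    rw [hh', h0, map_zero, neg_zero]
  obtain ⟨h, hh⟩ := LinearMap.surjective_of_injective hinj g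
  exact ⟨h, eq_sub_of_add_eq hh⟩

theorem tendsto_infoVecMap {J : ℕ → M.FactorInfo} {J' : M.FactorInfo} (hJ' : M.IsPSDInit J')
    (hJ : ∀ n, ∀ i ∈ M.scope n, Tendsto (fun l => J l n i) atTop (𝓝 (J' n i)))
    (y : (n : F) → (Fin (M.obs n) → ℝ)) (h : M.FactorMean) (n : F) (i : V) :
    Tendsto (fun l => infoVecConst y (M.varInfo (J l)) n i - infoVecMap (M.varInfo (J l)) h n i)
      atTop (𝓝 (infoVecConst y (M.varInfo J') n i - infoVecMap (M.varInfo J') h n i)) := by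
  have hK := fun j n => tendsto_varInfo hJ j n
  have hC := (tendsto_factorInfo hJ'.isPosDefInfo_varInfo hK n i).1
  have hmul : ∀ {a b : ℕ} {X : ℕ → Matrix (Fin a) (Fin b) ℝ} {X' : Matrix (Fin a) (Fin b) ℝ}
      {z : ℕ → Fin b → ℝ} {z' : Fin b → ℝ}, Tendsto X atTop (𝓝 X') → Tendsto z atTop (𝓝 z') →
      Tendsto (fun l => X l *ᵥ z l) atTop (𝓝 (X' *ᵥ z')) := fun {a b X X' z z'} hX hz => by
    have hcont : Continuous fun p : Matrix (Fin a) (Fin b) ℝ × (Fin b → ℝ) => p.1 *ᵥ p.2 := by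
      fun_prop
    exact (hcont.tendsto (X', z')).comp (hX.prodMk_nhds hz)
  refine (hmul tendsto_const_nhds (hmul hC tendsto_const_nhds)).sub
    (hmul tendsto_const_nhds (hmul hC (tendsto_finsetSum _ fun j _ =>
      hmul tendsto_const_nhds (hmul ?_ tendsto_const_nhds))))
  exact (hJ'.isPosDefInfo_varInfo j n).tendsto_inv (hK j n)

/-- The information vectors of the messages converge to any fixed point of the limiting
recursion. -/
theorem tendsto_infoVec [Fintype V] (hM : IsSingleLoopWithForest M.factorGraph)
    {J J₀ : M.FactorInfo} (hJ : M.IsPSDInit J) (hfix : M.factorInfo (M.varInfo J) = J)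
    (hJ₀ : M.IsPSDInit J₀) (y : (n : F) → (Fin (M.obs n) → ℝ)) (v₀ h : M.FactorMean)
    (hh : h = infoVecConst y (M.varInfo J) - infoVecMap (M.varInfo J) h)
    {n : F} {i : V} (hi : i ∈ M.scope n) :
    Tendsto (fun l => M.infoSeq J₀ l n i *ᵥ M.meanSeq y J₀ v₀ l n i) atTop (𝓝 (h n i)) := by
  obtain ⟨w, ρ, hw, hρ0, hρ1, hcon⟩ := exists_infoVecMap_contraction hM
  have hpd : ∀ n, ∀ i ∈ M.scope n, (J n i).PosDef := fun n i hi => by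
    rw [← hfix]; exact hJ.isPosDefInfo_varInfo.posDef_factorInfo hi
  have hlim := fun n i hi => tendsto_infoSeq hJ hfix hJ₀ n i hi
  have hpdSeq : ∀ l n, ∀ i ∈ M.scope n, (M.infoSeq J₀ (l + 1) n i).PosDef := fun l n i hi =>
    (hJ₀.infoSeq l).isPosDefInfo_varInfo.posDef_factorInfo hi
  have hbd : ∀ l, M.IsBoundedInfo (M.infoSeq J₀ (l + 1)) := fun l =>
    (hJ₀.infoSeq l).isBoundedInfo_factorInfo
  set K := fun l => M.varInfo (M.infoSeq J₀ l)
  set e : ℕ → M.FactorMean := fun l n i =>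
    M.infoSeq J₀ l n i *ᵥ M.meanSeq y J₀ v₀ l n i - h n i
  set δ : ℕ → M.FactorMean := fun l => infoVecConst y (K l) - infoVecMap (K l) h - h
  have hstep : ∀ l n, ∀ i ∈ M.scope n, e (l + 1) n i = (-infoVecMap (K l) (e l) + δ l) n i := by
    intro l n i hi
    have he : e l = (fun n i => M.infoSeq J₀ l n i *ᵥ M.meanSeq y J₀ v₀ l n i) - h := rfl
    rw [he, map_sub]
    have := factorInfo_mulVec_factorMean y (hJ₀.infoSeq l) (M.meanSeq y J₀ v₀ l) hi
    simp only [e, δ, LinearGaussianModel.infoSeq, meanSeq, Pi.add_apply, Pi.sub_apply,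
      Pi.neg_apply, this, K]
    abel
  have hδ : ∀ n, ∀ i ∈ M.scope n, Tendsto (fun l => δ (l + 1) n i) atTop (𝓝 0) := by
    intro n i hi
    have h1 := (tendsto_infoVecMap hJ hlim y h n i).sub_const (h n i)
    have h2 : infoVecConst y (M.varInfo J) n i - infoVecMap (M.varInfo J) h n i = h n i :=
      (congrFun (congrFun hh n) i).symm
    rw [h2, sub_self] at h1
    exact (tendsto_add_atTop_iff_nat 1).2 h1
  set s : ℕ → ℝ := fun l => dualNorm w (M.infoSeq J₀ (l + 2)) (δ (l + 1))
  have hs : Tendsto s atTop (𝓝 0) := tendsto_dualNorm_zero w hpd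
    (fun n i hi => (tendsto_add_atTop_iff_nat 2).2 (hlim n i hi)) hδ
  have hs0 : ∀ l, 0 ≤ s l := fun l => dualNorm_nonneg hw _ _
  let T : ℕ → ℝ := fun l =>
    Nat.rec (dualNorm w (M.infoSeq J₀ 1) (e 1)) (fun l t => ρ * t + s l) l
  have hTsucc : ∀ l, T (l + 1) = ρ * T l + s l := fun l => rfl
  have hT0 : ∀ l, 0 ≤ T l := by
    intro l
    induction l with
    | zero => exact dualNorm_nonneg hw _ _
    | succ l ih => rw [hTsucc]; exact add_nonneg (mul_nonneg hρ0 ih) (hs0 l)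
  have hbound : ∀ l, IsDualBound w (M.infoSeq J₀ (l + 1)) (e (l + 1)) (T l) := by
    intro l
    induction l with
    | zero => exact isDualBound_dualNorm hw (hpdSeq 0) _
    | succ l ih =>
      intro n i hi x
      rw [hstep (l + 1) n i hi]
      exact ((hcon _ (hJ₀.infoSeq (l + 1)) (hbd l) _ _ (hT0 l) ih).neg.add
        (isDualBound_dualNorm hw (hpdSeq (l + 1)) (δ (l + 1)))) n i hi x
  have hzero : Tendsto (fun l => e (l + 1) n i) atTop (𝓝 0) :=
    IsDualBound.tendsto_zero hw hbd hT0 hbound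
      (tendsto_zero_of_affine_recursion hρ0 hρ1 hT0 (fun l => (hTsucc l).le) hs) hi
  have := ((tendsto_add_atTop_iff_nat (f := fun l => e l n i) 1).1 hzero).add_const (h n i)
  simpa [e] using this

theorem tendsto_varMeanSeq [Fintype V] (hM : IsSingleLoopWithForest M.factorGraph)
    {J J₀ : M.FactorInfo} (hJ : M.IsPSDInit J) (hfix : M.factorInfo (M.varInfo J) = J)
    (hJ₀ : M.IsPSDInit J₀) (y : (n : F) → (Fin (M.obs n) → ℝ)) (v₀ h : M.FactorMean)
    (hh : h = infoVecConst y (M.varInfo J) - infoVecMap (M.varInfo J) h) (n : F) (i : V) :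
    Tendsto (fun l => M.varMeanSeq y J₀ v₀ l i n) atTop
      (𝓝 ((M.varInfo J i n)⁻¹ *ᵥ ∑ k ∈ M.otherFactors i n, h k i)) := by
  have hK := (hJ.isPosDefInfo_varInfo i n).tendsto_inv
    (tendsto_varInfo (tendsto_infoSeq hJ hfix hJ₀) i n)
  have hsum : Tendsto (fun l => ∑ k ∈ M.otherFactors i n,
      M.infoSeq J₀ l k i *ᵥ M.meanSeq y J₀ v₀ l k i) atTop
      (𝓝 (∑ k ∈ M.otherFactors i n, h k i)) :=
    tendsto_finsetSum _ fun k hk =>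
      tendsto_infoVec hM hJ hfix hJ₀ y v₀ h hh (mem_otherFactors.1 hk).1
  have hcont : Continuous fun p : Matrix (Fin (M.dim i)) (Fin (M.dim i)) ℝ × (Fin (M.dim i) → ℝ)
      => p.1 *ᵥ p.2 := by fun_prop
  exact (hcont.tendsto _).comp (hK.prodMk_nhds hsum)

end LinearGaussianModel

theorem theorem6 {V F : Type*} [Fintype V] [DecidableEq V] [Fintype F] [DecidableEq F]
    (M : LinearGaussianModel V F) (hM : IsSingleLoopWithForest M.factorGraph) :
    (∀ (n : F), ∀ i ∈ M.scope n,
      ∃! Jstar : Matrix (Fin (M.dim i)) (Fin (M.dim i)) ℝ,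
        ∀ J₀ : M.FactorInfo, M.IsPSDInit J₀ →
          Tendsto (fun l => M.infoSeq J₀ l n i) atTop (𝓝 Jstar)) ∧
    (∀ (y : (n : F) → (Fin (M.obs n) → ℝ)) (n : F), ∀ i ∈ M.scope n,
      ∃! vstar : Fin (M.dim i) → ℝ,
        ∀ (J₀ : M.FactorInfo) (v₀ : M.FactorMean), M.IsPSDInit J₀ →
          Tendsto (fun l => M.varMeanSeq y J₀ v₀ l i n) atTop (𝓝 vstar)) := by
  obtain ⟨J, hJ, hfix⟩ := M.exists_fixedPoint
  have hzero := LinearGaussianModel.isPSDInit_zero M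
  refine ⟨fun n i hi => ?_, fun y n i _ => ?_⟩
  · have hlim := fun J₀ hJ₀ => LinearGaussianModel.tendsto_infoSeq (J₀ := J₀) hJ hfix hJ₀ n i hi
    exact ⟨J n i, hlim, fun J' hJ' => tendsto_nhds_unique (hJ' 0 hzero) (hlim 0 hzero)⟩
  · obtain ⟨h, hh⟩ := LinearGaussianModel.exists_infoVec_fixedPoint hM hJ hfix
      (LinearGaussianModel.infoVecConst y (M.varInfo J))
    have hlim := fun J₀ v₀ hJ₀ => LinearGaussianModel.tendsto_varMeanSeq (J₀ := J₀) hM hJ hfix hJ₀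
      y v₀ h hh n i
    exact ⟨_, hlim, fun v' hv' =>
      tendsto_nhds_unique (hv' 0 0 hzero) (hlim 0 0 hzero)⟩
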